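/- **Theorem (exact finite convergence of the primal conical internal evolutive algorithm).** Let $G$ be a real $n\times m$ matrix, $\mathbf v\in\mathbb R^n$ and $f\in\mathbb R^m$, and consider the problem of maximizing $fx$ subject to $Gx\le\mathbf v$. Let $\widehat G$ be $G$ with the additional last row $-f$, let $\widehat{\mathbf v}(h)\in\mathbb R^{n+1}$ be $\mathbf v$ with the additional last entry $-h$, let $F=\mathcal R(\widehat G)\subset\mathbb R^{n+1}$ be the range of $\widehat G$, and let $P$ be the non-negative orthant of $\mathbb R^{n+1}$. For real $h$ let $\upsilon(h)$ be the orthogonal projection of $\widehat{\mathbf v}(h)$ on $F^\perp$, $V(h)$ the span of $\upsilon(h)$, $T(h)=I-(P_{V(h)}+P_F)$ with $P_{V(h)},P_F$ the orthogonal projections on $V(h)$ and $F$, so that the null space of $T(h)$ is $V(h)+F$, and let $P_c(h)=(\widehat{\mathbf v}(h)+F)\cap P$. A *generator* of the cone $\mathcal N(T(h))\cap P$ is a nonzero vector spanning an extreme ray of it. To *calibrate* a generator $y=\beta\upsilon(h)+z$ ($z\in F$) means to replace it by $y/\beta$; the result is a *calibrated generator* if it is a generator lying in $P_c(h)$. Assume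 that the augmented problem is strictly tangent, i.e. $F\cap P=\{0\}$, and that $\{x: Gx\le\mathbf v\}\neq\emptyset$. Then $fx$ attains a maximum $h_o$ on $\{x:Gx\le \mathbf v\}$. Fix any $h<h_o$, let $r$ be the rank of $T(h)$, and list in any order, each once, the $r$-element sets $B$ of columns other than the last one. The algorithm starts with $h(0)=h$. In step $i=1,2,\dots$ it resumes the search through the list where step $i-1$ left it (at the beginning if $i=1$), using the matrix $T(h(i-1))$: a set $B$ is successful if the columns of $T(h(i-1))$ in $B$ are linearly independent and the last column (the test column) is a linear combination of them with coefficients $\le 0$; the vector $y\ge 0$ found then has last entry $1$, the negatives of those coefficients at the positions in $B$, and zeros elsewhere, so $T(h(i-1))y=0$. At the first successful $B$, the vector $y$ is calibrated to give $g(i)$, and $h(i)=h(i-1)+g(i)_{n+1}$. If the list is exhausted without success, the loop is exited with the last value $h(j)$ obtained, where $j$ is the number of generators found. Then: 1. the loop is exited after finitely many steps; 2. if the loop is exited at $i=j$, then $h(j)=h_o$; 3. in every step $i\le j$, the vector $g(i)$ is a calibrated generator of $\mathcal N(T(h(i-1)))\cap P$ with $g(i)_{n+1}>0$, and $h(i)=h(i-1)+g(i)_{n+1}$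 (so $h$ strictly increases). -/

import Mathlib

open scoped InnerProductSpace

noncomputable section

/-- The data of the problem: maximize `f x` subject to `G x ≤ v`, where `G` is an `n × m` matrix. -/
structure LinearProgram (n m : ℕ) where
  G : Matrix (Fin n) (Fin m) ℝ
  v : Fin n → ℝ
  f : Fin m → ℝ

/-- The augmented space `ℝ^(n+1)` with its Euclidean structure. -/
abbrev AugSpace (n : ℕ) : Type := EuclideanSpace ℝ (Fin (n + 1))

/-- The non-negative orthant `P` of the augmented space. -/
def nonnegOrthant (n : ℕ) : Set (AugSpace n) := {y | ∀ k, 0 ≤ y k}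

/-- A subspace is strictly tangent to the orthant if it meets it in the origin only. -/
def StrictlyTangent {n : ℕ} (F : Submodule ℝ (AugSpace n)) : Prop :=
  (F : Set (AugSpace n)) ∩ nonnegOrthant n = {0}

/-- `y` is a generator of the cone `K`, that is, a nonzero vector spanning an extreme ray of `K`. -/
def IsConeGenerator {n : ℕ} (K : Set (AugSpace n)) (y : AugSpace n) : Prop :=
  y ∈ K ∧ y ≠ 0 ∧ ∀ a ∈ K, ∀ b ∈ K, a + b = y → ∃ t : ℝ, a = t • y

/-- The procedure examines a set `B` of columns of `M`, the last column being the test column.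
The columns in `B` have to be linearly independent (basic), and the last column has to be a
combination of them with coefficients `≤ 0`; the coefficients `-y k` of that combination, completed
by a last entry `1` and by zeros, form the vector `y` of the null space of `M`. -/
def IsBasicVector {n : ℕ} (M : Matrix (Fin (n + 1)) (Fin (n + 1)) ℝ) (B : Finset (Fin n))
    (y : AugSpace n) : Prop :=
  LinearIndependent ℝ (fun k : B => M.col (k : Fin n).castSucc) ∧
    M.toEuclideanLin y = 0 ∧ y ∈ nonnegOrthant n ∧ y (Fin.last n) = 1 ∧
    ∀ k, k ∉ B → y k.castSucc = 0

/-- The vector found with the basic columns `B` is unique. -/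
theorem IsBasicVector.unique {n : ℕ} {M : Matrix (Fin (n + 1)) (Fin (n + 1)) ℝ}
    {B : Finset (Fin n)} {y z : AugSpace n} (hy : IsBasicVector M B y)
    (hz : IsBasicVector M B z) : y = z := by
  obtain ⟨hB, hy0, -, hy1, hyB⟩ := hy
  obtain ⟨-, hz0, -, hz1, hzB⟩ := hz
  have h0 : M.toEuclideanLin (y - z) = 0 := by rw [map_sub, hy0, hz0, sub_zero]
  have h1 : ∑ k : B, (y - z) (k : Fin n).castSucc • M.col (k : Fin n).castSucc = 0 := by
    funext i
    have h2 := congrArg (fun w : AugSpace n => w i) h0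
    simp only [Matrix.toLpLin_apply, Matrix.mulVec, dotProduct, Fin.sum_univ_castSucc] at h2
    have h3 : (y - z) (Fin.last n) = 0 := by simp [hy1, hz1]
    rw [h3, mul_zero, add_zero] at h2
    simp only [Finset.sum_apply, Pi.smul_apply, smul_eq_mul, Matrix.col_apply, Pi.zero_apply]
    rw [Finset.sum_coe_sort B (fun k => (y - z) k.castSucc * M i k.castSucc)]
    rw [Finset.sum_subset (Finset.subset_univ B)]
    · simpa [mul_comm] using h2
    · intro k _ hk
      simp [hyB k hk, hzB k hk]
  have h4 := Fintype.linearIndependent_iff.1 hB _ h1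
  ext k
  refine Fin.lastCases ?_ (fun k => ?_) k
  · rw [hy1, hz1]
  · by_cases hk : k ∈ B
    · have := h4 ⟨k, hk⟩
      simpa [sub_eq_zero] using this
    · rw [hyB k hk, hzB k hk]

open Classical in
/-- The outcome of the examination of `B`: a vector as in `IsBasicVector`, if there is one (it is
then unique). -/
def basicVector {n : ℕ} (M : Matrix (Fin (n + 1)) (Fin (n + 1)) ℝ) (B : Finset (Fin n)) :
    Option (AugSpace n) :=
  if hy : ∃ y, IsBasicVector M B y then some hy.choose else none

/-- The search through a list of column sets, up to the first success: it returns the vector found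
and the column sets that have not been examined yet, and `none` if the list is exhausted. -/
def generatorSearch {n : ℕ} (M : Matrix (Fin (n + 1)) (Fin (n + 1)) ℝ) :
    List (Finset (Fin n)) → Option (AugSpace n × List (Finset (Fin n)))
  | [] => none
  | B :: rest =>
    match basicVector M B with
    | some y => some (y, rest)
    | none => generatorSearch M rest

/-- The memory of the evolutive algorithm between two steps: the current value of `h` and the
column sets that have not been examined yet. -/
structure EvolutiveState (n : ℕ) where
  h : ℝ
  rest : List (Finset (Fin n))

namespace LinearProgram

variable {n m : ℕ}

/-- The set of feasible points. -/
def feasibleSet (lp : LinearProgram n m) : Set (Fin m → ℝ) := {x | lp.G.mulVec x ≤ lp.v}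

/-- `c` is the maximum of the functional on the set of feasible points. -/
def IsOptimalValue (lp : LinearProgram n m) (c : ℝ) : Prop :=
  IsGreatest ((fun x => lp.f ⬝ᵥ x) '' lp.feasibleSet) c

/-- The augmented coefficient matrix: `G` with the additional last row `-f`. -/
def augMatrix (lp : LinearProgram n m) : Matrix (Fin (n + 1)) (Fin m) ℝ :=
  Matrix.of (Fin.snoc (α := fun _ => Fin m → ℝ) lp.G (-lp.f))

/-- The augmented bound vector: `v` with the additional last entry `-h`. -/
def augBound (lp : LinearProgram n m) (h : ℝ) : AugSpace n :=
  WithLp.toLp 2 (Fin.snoc (α := fun _ => ℝ) lp.v (-h))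

/-- The range `F` of the augmented coefficient matrix. -/
def rangeSpace (lp : LinearProgram n m) : Submodule ℝ (AugSpace n) :=
  LinearMap.range (Matrix.toEuclideanLin lp.augMatrix)

/-- The orthogonal projection `υ(h)` of the augmented bound vector on the orthogonal complement
of `F`. -/
def upsilon (lp : LinearProgram n m) (h : ℝ) : AugSpace n :=
  lp.rangeSpaceᗮ.starProjection (lp.augBound h)

/-- The matrix `T = I - (P_V + P_F)`, where `V` is the span of `υ(h)` and `P_V`, `P_F` are the
orthogonal projections on `V` and `F`. -/
def testMatrix (lp : LinearProgram n m) (h : ℝ) : Matrix (Fin (n + 1)) (Fin (n + 1)) ℝ :=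
  Matrix.toEuclideanLin.symm
    (LinearMap.id - (((ℝ ∙ lp.upsilon h).starProjection : AugSpace n →ₗ[ℝ] AugSpace n) +
      (lp.rangeSpace.starProjection : AugSpace n →ₗ[ℝ] AugSpace n)))

theorem upsilon_mem_orthogonal (lp : LinearProgram n m) (h : ℝ) :
    lp.upsilon h ∈ lp.rangeSpaceᗮ :=
  Submodule.starProjection_apply_mem _ _

/-- The null space of `T` is the sum `V + F`. -/
theorem testMatrix_apply_eq_zero_iff (lp : LinearProgram n m) (h : ℝ) (y : AugSpace n) :
    (lp.testMatrix h).toEuclideanLin y = 0 ↔ y ∈ (ℝ ∙ lp.upsilon h) ⊔ lp.rangeSpace := by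
  have hT : (lp.testMatrix h).toEuclideanLin y =
      y - ((ℝ ∙ lp.upsilon h).starProjection y + lp.rangeSpace.starProjection y) := by
    simp only [testMatrix, LinearEquiv.apply_symm_apply]
    rfl
  rw [hT, sub_eq_zero]
  constructor
  · intro hy
    rw [hy]
    exact Submodule.add_mem_sup (Submodule.starProjection_apply_mem _ _)
      (Submodule.starProjection_apply_mem _ _)
  · intro hy
    obtain ⟨a, ha, z, hz, rfl⟩ := Submodule.mem_sup.1 hy
    have hu := lp.upsilon_mem_orthogonal h
    have ha' : a ∈ lp.rangeSpaceᗮ := by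
      obtain ⟨t, rfl⟩ := Submodule.mem_span_singleton.1 ha
      exact Submodule.smul_mem _ _ hu
    have hz' : z ∈ (ℝ ∙ lp.upsilon h)ᗮ := by
      rw [Submodule.mem_orthogonal_singleton_iff_inner_left]
      exact Submodule.inner_right_of_mem_orthogonal hz hu
    rw [map_add, map_add, Submodule.starProjection_eq_self_iff.2 ha,
      Submodule.starProjection_eq_self_iff.2 hz,
      (Submodule.starProjection_apply_eq_zero_iff _).2 hz',
      (Submodule.starProjection_apply_eq_zero_iff _).2 ha', add_zero, zero_add]

/-- The cone `N(T) ∩ P`. -/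
def nullCone (lp : LinearProgram n m) (h : ℝ) : Set (AugSpace n) :=
  {y | (lp.testMatrix h).toEuclideanLin y = 0} ∩ nonnegOrthant n

/-- The contact polytope `P_c(h)`: the non-negative vectors of the affine space obtained by
translating `F` by the augmented bound vector. -/
def contactPolytope (lp : LinearProgram n m) (h : ℝ) : Set (AugSpace n) :=
  {y | y - lp.augBound h ∈ lp.rangeSpace} ∩ nonnegOrthant n

/-- A calibrated generator: a generator of `N(T) ∩ P` that lies in the contact polytope. -/
def IsCalibratedGenerator (lp : LinearProgram n m) (h : ℝ) (g : AugSpace n) : Prop :=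
  IsConeGenerator (lp.nullCone h) g ∧ g ∈ lp.contactPolytope h

/-- The number `β` such that the orthogonal projection of `y` on the complement of `F` is
`β υ(h)`, see `proj_eq_calibrationFactor_smul`. -/
def calibrationFactor (lp : LinearProgram n m) (h : ℝ) (y : AugSpace n) : ℝ :=
  ⟪lp.upsilon h, y⟫_ℝ / ⟪lp.upsilon h, lp.upsilon h⟫_ℝ

theorem proj_eq_calibrationFactor_smul (lp : LinearProgram n m) (h : ℝ) (y : AugSpace n)
    (hy : (lp.testMatrix h).toEuclideanLin y = 0) :
    lp.rangeSpaceᗮ.starProjection y = lp.calibrationFactor h y • lp.upsilon h := by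
  rw [testMatrix_apply_eq_zero_iff] at hy
  obtain ⟨a, ha, z, hz, rfl⟩ := Submodule.mem_sup.1 hy
  obtain ⟨t, rfl⟩ := Submodule.mem_span_singleton.1 ha
  have hu := lp.upsilon_mem_orthogonal h
  have hz0 : ⟪lp.upsilon h, z⟫_ℝ = 0 := Submodule.inner_left_of_mem_orthogonal hz hu
  rw [map_add, Submodule.starProjection_eq_self_iff.2 (Submodule.smul_mem _ t hu),
    (Submodule.starProjection_apply_eq_zero_iff _).2 (Submodule.le_orthogonal_orthogonal _ hz),
    add_zero, calibrationFactor, inner_add_right, hz0, add_zero, inner_smul_right]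
  by_cases h0 : lp.upsilon h = 0
  · simp [h0]
  · rw [mul_div_assoc, div_self (inner_self_ne_zero.2 h0), mul_one]

/-- Calibration: the passage from `y = β υ + z`, with `z` in `F`, to `y / β`. -/
def calibrate (lp : LinearProgram n m) (h : ℝ) (y : AugSpace n) : AugSpace n :=
  (lp.calibrationFactor h y)⁻¹ • y

/-- `L` lists, in some order and each of them once, the sets of `r` columns other than the last
one, where `r` is the rank of the matrix `T` computed with the initial value `h`. -/
def IsColumnEnumeration (lp : LinearProgram n m) (h : ℝ) (L : List (Finset (Fin n))) : Prop :=
  L.Nodup ∧ ∀ B, B ∈ L ↔ B.card = (lp.testMatrix h).rank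

/-- One step of the evolutive algorithm: resume the search with the matrix `T` of the current `h`;
if a generator is found, calibrate it and add its last coordinate to `h`. The value is `none` if
the search terminates without a generator. -/
def evolutiveStep (lp : LinearProgram n m) (s : EvolutiveState n) : Option (EvolutiveState n) :=
  match generatorSearch (lp.testMatrix s.h) s.rest with
  | some (y, rest) => some ⟨s.h + lp.calibrate s.h y (Fin.last n), rest⟩
  | none => none

/-- The state after `i` steps of the algorithm started with the value `h` and the list `L`
(`none` if the loop has been exited before). -/
def evolutiveRun (lp : LinearProgram n m) (h : ℝ) (L : List (Finset (Fin n))) :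
    ℕ → Option (EvolutiveState n)
  | 0 => some ⟨h, L⟩
  | i + 1 => (lp.evolutiveRun h L i).bind lp.evolutiveStep

/-- The loop is exited at `i = j`, with final state `s`: `j` steps have been performed, and the
search terminates without a further generator. -/
def ExitsAt (lp : LinearProgram n m) (h : ℝ) (L : List (Finset (Fin n))) (j : ℕ)
    (s : EvolutiveState n) : Prop :=
  lp.evolutiveRun h L j = some s ∧ lp.evolutiveStep s = none

end LinearProgram

end

/-!
Let `b(h)` be the augmented bound vector `v̂(h)` and `e` the last coordinate vector, so that
`b(h) = b(h') + (h' - h) e`. Modulo `F`, the null space of `T(h)` is spanned by `b(h)`: a vector `y`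
is in it if and only if `y - β b(h) ∈ F` for some `β`, and calibration divides by this `β`. The
vectors of the contact polytope are the slack vectors of the feasible points with `f x ≥ h`. Strict
tangency makes these polytopes compact (`isCompact_contactPolytope`), so the maximum `ho` is
attained. It also makes the image of the orthant in the quotient by `F` a pointed cone, so
`b(h) ∉ F` for `h < ho`, the rank of `T(h)` is the same for all these `h`, and `β > 0` for
nonzero vectors of the cone `N(T(h)) ∩ P` as long as `h ≤ ho` (`IsOptimalValue.calibration_pos`).
Since the vector found has last entry `1`, a success raises `h` by `β⁻¹ > 0`, and the calibrated
vector shows that the new value is still at most `ho`.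

The heart of the matter is that resuming the search loses nothing. In the quotient by `F`, let `H`
be the span of the classes of the coordinate vectors with indices in `B`. If `B` is successful at
`h`, the line of the classes of `b(·)` meets `H` at the single parameter `h + β⁻¹`, in a point of
the cone generated by these classes, and among the values up to `ho` those with `B` successful are
the ones below this parameter. Therefore success at `h'` implies success at every smaller `h`
(`IsOptimalValue.exists_isBasicVector_of_le`), and a set that has just been used fails at the next
value (`IsOptimalValue.not_isBasicVector_add_inv`). So the sets already examined all fail with
the current matrix (`IsOptimalValue.evolutiveRun_invariant`). The loop is finite because the
remaining list gets shorter.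

Finally, if `h < ho`, some set in the list is successful (`IsOptimalValue.exists_isBasicVector`):
a vector of the contact polytope with positive last entry and minimal support has its support
independent modulo `F`, by the ratio test, and the support can be completed to a basis of the
quotient by `F`. Hence an exit is possible only at `ho`. The vector found spans an extreme ray
because the vectors of the null space supported in its set of indices form a line.
-/

open scoped InnerProductSpace

/-! ### Independence of columns and of coordinate vectors -/

/-- The columns of `M` in `B` are linearly independent if and only if no nonzero vector of the null
space of `M` is supported in `B`. -/
theorem linearIndependent_col_iff {n : ℕ} (M : Matrix (Fin (n + 1)) (Fin (n + 1)) ℝ)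
    (B : Finset (Fin n)) :
    LinearIndependent ℝ (fun k : B => M.col (k : Fin n).castSucc) ↔
      ∀ z : AugSpace n, M.toEuclideanLin z = 0 → z (Fin.last n) = 0 →
        (∀ k, k ∉ B → z k.castSucc = 0) → z = 0 := by
  have key : ∀ z : AugSpace n, z (Fin.last n) = 0 → (∀ k, k ∉ B → z k.castSucc = 0) →
      (M.toEuclideanLin z = 0 ↔
        ∑ k : B, z (k : Fin n).castSucc • M.col (k : Fin n).castSucc = 0) := by
    intro z hl hB
    have h : ∀ i, M.toEuclideanLin z i =
        (∑ k : B, z (k : Fin n).castSucc • M.col (k : Fin n).castSucc) i := by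
      intro i
      simp only [Matrix.toLpLin_apply, Matrix.mulVec, dotProduct, Fin.sum_univ_castSucc, hl,
        mul_zero, add_zero, Finset.sum_apply, Pi.smul_apply, smul_eq_mul, Matrix.col_apply]
      rw [Finset.sum_coe_sort B (fun k => z k.castSucc * M i k.castSucc)]
      rw [Finset.sum_subset (Finset.subset_univ B) fun k _ hk => by simp [hB k hk]]
      exact Finset.sum_congr rfl fun k _ => mul_comm _ _
    constructor
    · intro hz
      funext i
      rw [← h i, hz]
      rfl
    · intro hz
      ext i
      rw [h i, hz]
      rfl
  rw [Fintype.linearIndependent_iff]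
  constructor
  · intro hB z hz hl hs
    have h := hB _ ((key z hl hs).1 hz)
    ext k
    refine Fin.lastCases hl (fun k => ?_) k
    by_cases hk : k ∈ B
    · exact h ⟨k, hk⟩
    · exact hs k hk
  · intro hz c hc k
    let z : AugSpace n := WithLp.toLp 2 (Fin.snoc (α := fun _ => ℝ)
      (fun k => if hk : k ∈ B then c ⟨k, hk⟩ else 0) 0)
    have hl : z (Fin.last n) = 0 := by simp [z]
    have hs : ∀ k, k ∉ B → z k.castSucc = 0 := by
      intro k hk
      simp [z, hk]
    have hzk : ∀ k : B, z (k : Fin n).castSucc = c k := by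
      intro k
      simp [z]
    have h0 : z = 0 := hz z ((key z hl hs).2 (by simpa only [hzk] using hc)) hl hs
    rw [← hzk k, h0]
    rfl

/-- The classes modulo `F` of the coordinate vectors with indices in `D` are linearly independent
if and only if no nonzero vector of `F` is supported in `D`. -/
theorem linearIndepOn_mkQ_single_iff {n : ℕ} (F : Submodule ℝ (AugSpace n))
    (D : Set (Fin (n + 1))) :
    LinearIndepOn ℝ (fun k => F.mkQ (EuclideanSpace.single k (1 : ℝ))) D ↔
      ∀ z ∈ F, (∀ k, k ∉ D → z k = 0) → z = 0 := by
  classical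
  lift D to Finset (Fin (n + 1)) using D.toFinite
  rw [linearIndepOn_finset_iff]
  have key : ∀ c : Fin (n + 1) → ℝ, (∀ k, k ∉ D → c k = 0) →
      ∑ k ∈ D, c k • F.mkQ (EuclideanSpace.single k (1 : ℝ)) = F.mkQ (WithLp.toLp 2 c) := by
    intro c hc
    have h : (WithLp.toLp 2 c : AugSpace n) =
        ∑ k ∈ D, c k • EuclideanSpace.single k (1 : ℝ) := by
      ext i
      by_cases hi : i ∈ D
      · simp [Pi.single_apply, hi]
      · simp [Pi.single_apply, hi, hc i hi]
    rw [h, map_sum]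
    simp only [map_smul]
  constructor
  · intro h z hz hs
    have h1 := h z.ofLp (by
      rw [key _ fun k hk => hs k (by simpa using hk)]
      simpa using hz)
    ext k
    by_cases hk : k ∈ D
    · exact h1 k hk
    · exact hs k (by simpa using hk)
  · intro h c hc k hk
    let c' : Fin (n + 1) → ℝ := fun k => if k ∈ D then c k else 0
    have h2 : ∑ k ∈ D, c' k • F.mkQ (EuclideanSpace.single k (1 : ℝ)) = 0 := by
      rw [← hc]
      exact Finset.sum_congr rfl fun k hk => by simp [c', hk]
    rw [key c' fun k hk => by simp [c', hk]] at h2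
    have h3 := h (WithLp.toLp 2 c') (by simpa using h2) (fun k hk => by
      have hk' : k ∉ D := by simpa using hk
      simp [c', hk'])
    have h4 : c' k = 0 := congrArg (fun w : AugSpace n => w k) h3
    simpa [c', hk] using h4

/-- A set of coordinate vectors that is independent modulo `F` and contains the last one can be
enlarged to a basis modulo `F`. -/
theorem exists_card_eq_of_independent_mod {n : ℕ} (F : Submodule ℝ (AugSpace n))
    (S : Finset (Fin n))
    (hS : ∀ z ∈ F, (∀ k, k ∉ S → z k.castSucc = 0) → z = 0) :
    ∃ B : Finset (Fin n), S ⊆ B ∧ B.card + 1 + Module.finrank ℝ F = n + 1 ∧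
      ∀ z ∈ F, (∀ k, k ∉ B → z k.castSucc = 0) → z = 0 := by
  classical
  let v : Fin (n + 1) → AugSpace n ⧸ F := fun k => F.mkQ (EuclideanSpace.single k (1 : ℝ))
  have hind : LinearIndepOn ℝ v (insert (Fin.last n) (Fin.castSucc '' (S : Set (Fin n)))) := by
    rw [linearIndepOn_mkQ_single_iff]
    intro z hz hs
    exact hS z hz fun k hk => hs _ (by simp [hk, (Fin.castSucc_lt_last k).ne])
  obtain ⟨D, -, hSD, hspan, hD⟩ := exists_linearIndepOn_extension hind (Set.subset_univ _)
  have hspan' : Submodule.span ℝ (v '' D) = ⊤ := by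
    rw [eq_top_iff]
    rintro q -
    obtain ⟨z, rfl⟩ := F.mkQ_surjective q
    have hz : z = ∑ k, z k • EuclideanSpace.single k (1 : ℝ) := by
      ext i
      simp [Pi.single_apply]
    rw [hz, map_sum]
    refine Submodule.sum_mem _ fun k _ => ?_
    rw [map_smul]
    exact Submodule.smul_mem _ _ (hspan ⟨k, Set.mem_univ k, rfl⟩)
  have hcard : Module.finrank ℝ (AugSpace n ⧸ F) = D.ncard := by
    have b : Module.Basis D ℝ (AugSpace n ⧸ F) := Module.Basis.mk (v := fun k : D => v k) hD (by
      rw [← hspan', Set.image_eq_range])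
    rw [Module.finrank_eq_nat_card_basis b]
    rfl
  have hlast : Fin.last n ∈ D := hSD (Set.mem_insert _ _)
  let B : Finset (Fin n) := Finset.univ.filter fun k => k.castSucc ∈ D
  have hDB : D = insert (Fin.last n) ((B.map Fin.castSuccEmb : Finset _) : Set (Fin (n + 1))) := by
    ext k
    refine Fin.lastCases ?_ (fun k => ?_) k
    · simp [hlast]
    · simp [B, (Fin.castSucc_lt_last k).ne]
  refine ⟨B, fun k hk => ?_, ?_, ?_⟩
  · simpa [B] using hSD (Set.mem_insert_of_mem _ ⟨k, hk, rfl⟩)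
  · have h1 : D.ncard = B.card + 1 := by
      rw [hDB, Set.ncard_insert_of_notMem, Set.ncard_coe_finset, Finset.card_map]
      simp [(Fin.castSucc_lt_last _).ne]
    have h2 := F.finrank_quotient_add_finrank
    rw [hcard, h1, finrank_euclideanSpace_fin] at h2
    exact h2
  · intro z hz hs
    refine (linearIndepOn_mkQ_single_iff F D).1 hD z hz fun k hk => ?_
    revert hk
    refine Fin.lastCases (fun hk => absurd hlast hk) (fun k hk => ?_) k
    exact hs k (by simpa [B] using hk)

/-! ### The null space of the test matrix and the contact polytope -/

/-- A nonnegative vector of a strictly tangent subspace vanishes. -/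
theorem StrictlyTangent.eq_zero {n : ℕ} {F : Submodule ℝ (AugSpace n)} (hF : StrictlyTangent F)
    {y : AugSpace n} (hy : y ∈ F) (hy0 : y ∈ nonnegOrthant n) : y = 0 := by
  have h : y ∈ (F : Set (AugSpace n)) ∩ nonnegOrthant n := ⟨hy, hy0⟩
  rw [hF] at h
  exact h

/-- The coordinate vector of the additional row. -/
noncomputable def lastVector (n : ℕ) : AugSpace n := EuclideanSpace.single (Fin.last n) (1 : ℝ)

@[simp] theorem lastVector_last (n : ℕ) : lastVector n (Fin.last n) = 1 := by
  simp [lastVector]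

@[simp] theorem lastVector_castSucc (n : ℕ) (k : Fin n) : lastVector n k.castSucc = 0 := by
  simp [lastVector, (Fin.castSucc_lt_last k).ne]

theorem lastVector_nonneg {n : ℕ} : lastVector n ∈ nonnegOrthant n := by
  intro k
  refine Fin.lastCases (by simp) (fun k => by simp) k

theorem nonnegOrthant_add_smul_lastVector {n : ℕ} {y : AugSpace n} (hy : y ∈ nonnegOrthant n)
    {t : ℝ} (ht : 0 ≤ t) : y + t • lastVector n ∈ nonnegOrthant n := by
  intro k
  simpa using add_nonneg (hy k) (mul_nonneg ht (lastVector_nonneg k))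

theorem nonnegOrthant_smul {n : ℕ} {y : AugSpace n} (hy : y ∈ nonnegOrthant n)
    {t : ℝ} (ht : 0 ≤ t) : t • y ∈ nonnegOrthant n :=
  fun k => mul_nonneg ht (hy k)

namespace LinearProgram

variable {n m : ℕ}

theorem augMatrix_mulVec_castSucc (lp : LinearProgram n m) (x : Fin m → ℝ) (i : Fin n) :
    lp.augMatrix.mulVec x i.castSucc = lp.G.mulVec x i := by
  have h : lp.augMatrix i.castSucc = lp.G i :=
    Fin.snoc_castSucc (α := fun _ => Fin m → ℝ) (-lp.f) lp.G i
  simp only [Matrix.mulVec, h]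

theorem augMatrix_mulVec_last (lp : LinearProgram n m) (x : Fin m → ℝ) :
    lp.augMatrix.mulVec x (Fin.last n) = -(lp.f ⬝ᵥ x) := by
  have h : lp.augMatrix (Fin.last n) = -lp.f :=
    Fin.snoc_last (α := fun _ => Fin m → ℝ) (-lp.f) lp.G
  simp only [Matrix.mulVec, h, neg_dotProduct]

theorem augBound_eq (lp : LinearProgram n m) (h h' : ℝ) :
    lp.augBound h = lp.augBound h' + (h' - h) • lastVector n := by
  ext k
  refine Fin.lastCases ?_ (fun k => ?_) k
  · simp [augBound]
    ring
  · simp [augBound]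

theorem augBound_sub_upsilon_mem (lp : LinearProgram n m) (h : ℝ) :
    lp.augBound h - lp.upsilon h ∈ lp.rangeSpace := by
  rw [upsilon, Submodule.starProjection_orthogonal_val]
  simp [Submodule.starProjection_apply_mem]

/-- The null space of `T(h)` consists of the vectors congruent to a multiple of the augmented bound
vector modulo `F`. -/
theorem testMatrix_apply_eq_zero_iff_exists (lp : LinearProgram n m) (h : ℝ) (y : AugSpace n) :
    (lp.testMatrix h).toEuclideanLin y = 0 ↔
      ∃ β : ℝ, y - β • lp.augBound h ∈ lp.rangeSpace := by
  rw [testMatrix_apply_eq_zero_iff, Submodule.mem_sup]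
  have hb := lp.augBound_sub_upsilon_mem h
  constructor
  · rintro ⟨a, ha, z, hz, rfl⟩
    obtain ⟨β, rfl⟩ := Submodule.mem_span_singleton.1 ha
    refine ⟨β, ?_⟩
    have := Submodule.sub_mem _ hz (Submodule.smul_mem _ β hb)
    convert this using 1
    module
  · rintro ⟨β, hβ⟩
    refine ⟨β • lp.upsilon h, Submodule.smul_mem _ _ (Submodule.mem_span_singleton_self _),
      y - β • lp.upsilon h, ?_, by module⟩
    have := Submodule.add_mem _ hβ (Submodule.smul_mem _ β hb)
    convert this using 1
    module

/-- If the augmented bound vector is not in `F`, the calibration factor of `y` is the number `β`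
for which `y` is congruent to `β v̂(h)` modulo `F`. -/
theorem calibrationFactor_eq (lp : LinearProgram n m) {h : ℝ}
    (hb : lp.augBound h ∉ lp.rangeSpace) {y : AugSpace n} {β : ℝ}
    (hy : y - β • lp.augBound h ∈ lp.rangeSpace) : lp.calibrationFactor h y = β := by
  have hu := lp.upsilon_mem_orthogonal h
  have hb' := lp.augBound_sub_upsilon_mem h
  have hu0 : lp.upsilon h ≠ 0 := by
    intro h0
    rw [h0, sub_zero] at hb'
    exact hb hb'
  have hz : y - β • lp.upsilon h ∈ lp.rangeSpace := by
    have := Submodule.add_mem _ hy (Submodule.smul_mem _ β hb')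
    convert this using 1
    module
  have hz0 : ⟪lp.upsilon h, y - β • lp.upsilon h⟫_ℝ = 0 :=
    Submodule.inner_left_of_mem_orthogonal hz hu
  rw [inner_sub_right, inner_smul_right, sub_eq_zero] at hz0
  rw [calibrationFactor, hz0, mul_div_assoc, div_self (inner_self_ne_zero.2 hu0), mul_one]

/-- The rank of `T(h)` does not depend on `h` as long as `v̂(h)` is not in `F`. -/
theorem rank_testMatrix (lp : LinearProgram n m) {h : ℝ}
    (hb : lp.augBound h ∉ lp.rangeSpace) :
    (lp.testMatrix h).rank + 1 + Module.finrank ℝ lp.rangeSpace = n + 1 := by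
  have hu0 : lp.upsilon h ≠ 0 := by
    intro h0
    have hb' := lp.augBound_sub_upsilon_mem h
    rw [h0, sub_zero] at hb'
    exact hb hb'
  have hker : LinearMap.ker (lp.testMatrix h).toEuclideanLin =
      (ℝ ∙ lp.upsilon h) ⊔ lp.rangeSpace := by
    ext y
    rw [LinearMap.mem_ker, testMatrix_apply_eq_zero_iff]
  have hdisj : (ℝ ∙ lp.upsilon h) ⊓ lp.rangeSpace = ⊥ := by
    rw [eq_bot_iff]
    rintro y ⟨hy1, hy2⟩
    obtain ⟨t, rfl⟩ := Submodule.mem_span_singleton.1 hy1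
    have h3 := Submodule.smul_mem _ t (lp.upsilon_mem_orthogonal h)
    exact inner_self_eq_zero.1 (Submodule.inner_right_of_mem_orthogonal hy2 h3)
  have h1 : Module.finrank ℝ (LinearMap.ker (lp.testMatrix h).toEuclideanLin) =
      1 + Module.finrank ℝ lp.rangeSpace := by
    have h := Submodule.finrank_sup_add_finrank_inf_eq (ℝ ∙ lp.upsilon h) lp.rangeSpace
    rw [hdisj, finrank_bot, finrank_span_singleton hu0, ← hker] at h
    exact h
  have h2 : Module.finrank ℝ (LinearMap.range (lp.testMatrix h).toEuclideanLin) +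
      Module.finrank ℝ (LinearMap.ker (lp.testMatrix h).toEuclideanLin) = n + 1 := by
    have h := LinearMap.finrank_range_add_finrank_ker (lp.testMatrix h).toEuclideanLin
    rw [finrank_euclideanSpace_fin] at h
    exact h
  have h3 : (lp.testMatrix h).rank =
      Module.finrank ℝ (LinearMap.range (lp.testMatrix h).toEuclideanLin) := by
    have h : Matrix.toEuclideanLin (𝕜 := ℝ) =
        Matrix.toLin (PiLp.basisFun 2 ℝ (Fin (n + 1))) (PiLp.basisFun 2 ℝ (Fin (n + 1))) :=
      Matrix.toLpLin_eq_toLin 2 2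
    rw [h]
    exact Matrix.rank_eq_finrank_range_toLin _ _ _
  omega

theorem isBasicVector_testMatrix_iff (lp : LinearProgram n m) (h : ℝ) (B : Finset (Fin n))
    (y : AugSpace n) :
    IsBasicVector (lp.testMatrix h) B y ↔
      (∀ (z : AugSpace n) (γ : ℝ), z - γ • lp.augBound h ∈ lp.rangeSpace →
        z (Fin.last n) = 0 → (∀ k, k ∉ B → z k.castSucc = 0) → z = 0) ∧
      (∃ β : ℝ, y - β • lp.augBound h ∈ lp.rangeSpace) ∧ y ∈ nonnegOrthant n ∧
      y (Fin.last n) = 1 ∧ ∀ k, k ∉ B → y k.castSucc = 0 := by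
  rw [IsBasicVector, linearIndependent_col_iff]
  simp only [testMatrix_apply_eq_zero_iff_exists, forall_exists_index]

/-- A vector of the contact polytope is the slack vector of a feasible point. -/
theorem exists_feasible_of_mem_contactPolytope (lp : LinearProgram n m) {h : ℝ} {g : AugSpace n}
    (hg : g ∈ lp.contactPolytope h) :
    ∃ x ∈ lp.feasibleSet, lp.f ⬝ᵥ x = h + g (Fin.last n) := by
  obtain ⟨⟨x, hx⟩, hg0⟩ := hg
  have hk : ∀ k, g k = lp.augBound h k + lp.augMatrix.mulVec x.ofLp k := by
    intro k
    have := congrArg (fun w : AugSpace n => w k) hx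
    simp only [Matrix.toLpLin_apply, PiLp.sub_apply] at this
    linarith
  refine ⟨-x.ofLp, fun i => ?_, ?_⟩
  · have h1 := hg0 i.castSucc
    rw [hk] at h1
    rw [augMatrix_mulVec_castSucc] at h1
    simp only [augBound, Fin.snoc_castSucc] at h1
    rw [Matrix.mulVec_neg, Pi.neg_apply]
    linarith
  · rw [hk, augMatrix_mulVec_last]
    simp [augBound]

/-- A feasible point with `f x ≥ h` provides a vector of the contact polytope. -/
theorem exists_mem_contactPolytope (lp : LinearProgram n m) {h : ℝ} {x : Fin m → ℝ}
    (hx : x ∈ lp.feasibleSet) (hh : h ≤ lp.f ⬝ᵥ x) :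
    ∃ g ∈ lp.contactPolytope h, g (Fin.last n) = lp.f ⬝ᵥ x - h := by
  refine ⟨lp.augBound h - lp.augMatrix.toEuclideanLin (WithLp.toLp 2 x), ⟨?_, fun k => ?_⟩, ?_⟩
  · refine ⟨-WithLp.toLp 2 x, ?_⟩
    rw [map_neg]
    abel
  · refine Fin.lastCases ?_ (fun i => ?_) k
    · simp [Matrix.toLpLin_apply, augBound, augMatrix_mulVec_last, hh]
    · simpa [Matrix.toLpLin_apply, augBound, augMatrix_mulVec_castSucc] using hx i
  · simp only [Matrix.toLpLin_apply, PiLp.sub_apply, augMatrix_mulVec_last, augBound, Fin.snoc_last]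
    ring

end LinearProgram

/-! ### Existence of the maximum -/

/-- A strictly tangent subspace makes a positive angle with the orthant: the projection on its
complement is bounded below there. -/
theorem StrictlyTangent.exists_pos_mul_norm_le {n : ℕ} {F : Submodule ℝ (AugSpace n)}
    (hF : StrictlyTangent F) :
    ∃ c : ℝ, 0 < c ∧ ∀ y ∈ nonnegOrthant n, c * ‖y‖ ≤ ‖Fᗮ.starProjection y‖ := by
  have hcl : IsClosed (nonnegOrthant n) := by
    simp only [nonnegOrthant, Set.ofPred_forall]
    exact isClosed_iInter fun k => isClosed_le continuous_const (by fun_prop)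
  have hK : IsCompact (Metric.sphere (0 : AugSpace n) 1 ∩ nonnegOrthant n) :=
    (isCompact_sphere _ _).inter_right hcl
  have hne : (Metric.sphere (0 : AugSpace n) 1 ∩ nonnegOrthant n).Nonempty :=
    ⟨lastVector n, by simp [lastVector], lastVector_nonneg⟩
  obtain ⟨y₀, ⟨hy₀, hy₀P⟩, hmin⟩ := hK.exists_isMinOn hne
    (f := fun y => ‖Fᗮ.starProjection y‖) (by fun_prop)
  refine ⟨‖Fᗮ.starProjection y₀‖, ?_, fun y hy => ?_⟩
  · rw [norm_pos_iff]
    intro h0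
    rw [Submodule.starProjection_apply_eq_zero_iff, Submodule.orthogonal_orthogonal] at h0
    rw [hF.eq_zero h0 hy₀P] at hy₀
    simp at hy₀
  · by_cases hy0 : y = 0
    · simp [hy0]
    have hpos : 0 < ‖y‖ := norm_pos_iff.2 hy0
    have h1 : ‖Fᗮ.starProjection y₀‖ ≤ ‖Fᗮ.starProjection (‖y‖⁻¹ • y)‖ :=
      hmin ⟨by simp [norm_smul, hpos.ne'], nonnegOrthant_smul hy (inv_nonneg.2 hpos.le)⟩
    rw [map_smul, norm_smul, norm_inv, norm_norm] at h1
    rw [mul_comm]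
    exact (le_inv_mul_iff₀ hpos).1 h1

namespace LinearProgram

variable {n m : ℕ}

theorem isCompact_contactPolytope (lp : LinearProgram n m) (hst : StrictlyTangent lp.rangeSpace)
    (h : ℝ) : IsCompact (lp.contactPolytope h) := by
  obtain ⟨c, hc, hcb⟩ := hst.exists_pos_mul_norm_le
  have hcl : IsClosed (lp.contactPolytope h) := by
    refine IsClosed.inter ?_ ?_
    · exact (Submodule.closed_of_finiteDimensional lp.rangeSpace).preimage
        (f := fun y : AugSpace n => y - lp.augBound h) (by fun_prop)
    · simp only [nonnegOrthant, Set.ofPred_forall]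
      exact isClosed_iInter fun k => isClosed_le continuous_const (by fun_prop)
  refine (isCompact_closedBall (0 : AugSpace n)
    (‖lp.rangeSpaceᗮ.starProjection (lp.augBound h)‖ / c)).of_isClosed_subset hcl ?_
  rintro y ⟨hyF, hyP⟩
  have h1 : lp.rangeSpaceᗮ.starProjection y = lp.rangeSpaceᗮ.starProjection (lp.augBound h) := by
    rw [← sub_eq_zero, ← map_sub, Submodule.starProjection_apply_eq_zero_iff,
      Submodule.orthogonal_orthogonal]
    exact hyF
  rw [mem_closedBall_zero_iff, le_div_iff₀ hc, mul_comm, ← h1]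
  exact hcb y hyP

theorem exists_isOptimalValue (lp : LinearProgram n m) (hst : StrictlyTangent lp.rangeSpace)
    (hfeas : lp.feasibleSet.Nonempty) : ∃ ho, lp.IsOptimalValue ho := by
  obtain ⟨x₀, hx₀⟩ := hfeas
  obtain ⟨g₀, hg₀, -⟩ := lp.exists_mem_contactPolytope hx₀ le_rfl
  obtain ⟨g, hg, hmax⟩ := (lp.isCompact_contactPolytope hst (lp.f ⬝ᵥ x₀)).exists_isMaxOn ⟨g₀, hg₀⟩
    (f := fun y => y (Fin.last n)) (by fun_prop)
  obtain ⟨x, hx, hfx⟩ := lp.exists_feasible_of_mem_contactPolytope hg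
  refine ⟨lp.f ⬝ᵥ x, ⟨x, hx, rfl⟩, ?_⟩
  rintro _ ⟨x', hx', rfl⟩
  rcases le_total (lp.f ⬝ᵥ x₀) (lp.f ⬝ᵥ x') with hle | hle
  · obtain ⟨g', hg', hg'l⟩ := lp.exists_mem_contactPolytope hx' hle
    have h1 : g' (Fin.last n) ≤ g (Fin.last n) := hmax hg'
    change lp.f ⬝ᵥ x' ≤ lp.f ⬝ᵥ x
    linarith
  · have := hg.2 (Fin.last n)
    change lp.f ⬝ᵥ x' ≤ lp.f ⬝ᵥ x
    linarith

theorem IsOptimalValue.exists_mem_contactPolytope {lp : LinearProgram n m} {ho h : ℝ}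
    (hopt : lp.IsOptimalValue ho) (hh : h ≤ ho) :
    ∃ g ∈ lp.contactPolytope h, g (Fin.last n) = ho - h := by
  obtain ⟨⟨x, hx, hfx⟩, -⟩ := hopt
  change lp.f ⬝ᵥ x = ho at hfx
  subst hfx
  exact lp.exists_mem_contactPolytope hx hh

theorem IsOptimalValue.add_last_le {lp : LinearProgram n m} {ho h : ℝ}
    (hopt : lp.IsOptimalValue ho) {g : AugSpace n} (hg : g ∈ lp.contactPolytope h) :
    h + g (Fin.last n) ≤ ho := by
  obtain ⟨x, hx, hfx⟩ := lp.exists_feasible_of_mem_contactPolytope hg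
  rw [← hfx]
  exact hopt.2 ⟨x, hx, rfl⟩

theorem IsOptimalValue.augBound_notMem {lp : LinearProgram n m} {ho h : ℝ}
    (hopt : lp.IsOptimalValue ho) (hst : StrictlyTangent lp.rangeSpace) (hh : h < ho) :
    lp.augBound h ∉ lp.rangeSpace := by
  intro hb
  obtain ⟨g, hg, hgl⟩ := hopt.exists_mem_contactPolytope hh.le
  have hgF : g ∈ lp.rangeSpace := by simpa using Submodule.add_mem _ hg.1 hb
  rw [hst.eq_zero hgF hg.2, PiLp.zero_apply] at hgl
  linarith

/-! ### Calibration -/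

/-- Nonzero vectors of the cone `N(T(h)) ∩ P` have a positive calibration factor: the projection of
the orthant on the complement of `F` is a pointed cone containing `υ(h)`. -/
theorem IsOptimalValue.calibration_pos {lp : LinearProgram n m} {ho h : ℝ}
    (hopt : lp.IsOptimalValue ho) (hst : StrictlyTangent lp.rangeSpace) (hh : h ≤ ho)
    {y : AugSpace n} (hy : y ∈ nonnegOrthant n) (hy0 : y ≠ 0) {β : ℝ}
    (hyβ : y - β • lp.augBound h ∈ lp.rangeSpace) : 0 < β := by
  by_contra! hβ
  obtain ⟨g, hg, -⟩ := hopt.exists_mem_contactPolytope hh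
  have hg0 : ∀ k, 0 ≤ -β * g k := fun k => mul_nonneg (neg_nonneg.2 hβ) (hg.2 k)
  have h1 : y + (-β) • g ∈ lp.rangeSpace := by
    have := Submodule.add_mem _ hyβ (Submodule.smul_mem _ (-β) hg.1)
    convert this using 1
    module
  have h2 := hst.eq_zero h1 fun k => by simpa using add_nonneg (hy k) (hg0 k)
  apply hy0
  ext k
  have h3 : y k + -β * g k = 0 := by simpa using congrArg (fun w : AugSpace n => w k) h2
  have := hy k
  have := hg0 k
  rw [PiLp.zero_apply]
  linarith

theorem inv_smul_mem_contactPolytope (lp : LinearProgram n m) {h β : ℝ} (hβ : 0 < β)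
    {y : AugSpace n} (hy : y ∈ nonnegOrthant n)
    (hyβ : y - β • lp.augBound h ∈ lp.rangeSpace) : β⁻¹ • y ∈ lp.contactPolytope h := by
  refine ⟨?_, nonnegOrthant_smul hy (inv_nonneg.2 hβ.le)⟩
  have := Submodule.smul_mem _ β⁻¹ hyβ
  rwa [smul_sub, smul_smul, inv_mul_cancel₀ hβ.ne', one_smul] at this

/-- The vector found by a successful examination is congruent to `β v̂(h)` modulo `F` for some
`β > 0`, and its calibration advances `h` by `β⁻¹` without exceeding the maximum. -/
theorem IsOptimalValue.exists_calibration {lp : LinearProgram n m} {ho h : ℝ}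
    (hopt : lp.IsOptimalValue ho) (hst : StrictlyTangent lp.rangeSpace) (hh : h ≤ ho)
    {B : Finset (Fin n)} {y : AugSpace n} (hy : IsBasicVector (lp.testMatrix h) B y) :
    ∃ β : ℝ, 0 < β ∧ y - β • lp.augBound h ∈ lp.rangeSpace ∧ h + β⁻¹ ≤ ho := by
  obtain ⟨-, ⟨β, hyβ⟩, hyP, hyl, -⟩ := (lp.isBasicVector_testMatrix_iff h B y).1 hy
  have hy0 : y ≠ 0 := by
    rintro rfl
    simp at hyl
  have hβ := hopt.calibration_pos hst hh hyP hy0 hyβ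
  refine ⟨β, hβ, hyβ, ?_⟩
  have := hopt.add_last_le (lp.inv_smul_mem_contactPolytope hβ hyP hyβ)
  simpa [hyl] using this

/-- The independence of the basic columns makes the vector found span an extreme ray: the summands
of a decomposition in the cone have the same support. -/
theorem isConeGenerator_smul_of_isBasicVector (lp : LinearProgram n m) {h : ℝ}
    {B : Finset (Fin n)} {y : AugSpace n} (hy : IsBasicVector (lp.testMatrix h) B y)
    {c : ℝ} (hc : 0 < c) : IsConeGenerator (lp.nullCone h) (c • y) := by
  obtain ⟨hB, hyT, hyP, hyl, hys⟩ := hy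
  rw [linearIndependent_col_iff] at hB
  refine ⟨⟨?_, nonnegOrthant_smul hyP hc.le⟩, ?_, ?_⟩
  · rw [Set.mem_ofPred_eq, map_smul, hyT, smul_zero]
  · intro h0
    have := congrArg (fun w : AugSpace n => w (Fin.last n)) h0
    simp [hyl, hc.ne'] at this
  · rintro a ⟨haT, haP⟩ b ⟨-, hbP⟩ hab
    have has : ∀ k, k ∉ B → a k.castSucc = 0 := by
      intro k hk
      have h1 : a k.castSucc + b k.castSucc = c * y k.castSucc := by
        simpa using congrArg (fun w : AugSpace n => w k.castSucc) hab
      rw [hys k hk, mul_zero] at h1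
      have := haP k.castSucc
      have := hbP k.castSucc
      linarith
    have h2 : a - a (Fin.last n) • y = 0 := by
      refine hB _ ?_ (by simp [hyl]) fun k hk => by simp [has k hk, hys k hk]
      rw [map_sub, map_smul, hyT, smul_zero, sub_zero]
      exact haT
    refine ⟨a (Fin.last n) * c⁻¹, ?_⟩
    rw [smul_smul, mul_assoc, inv_mul_cancel₀ hc.ne', mul_one]
    exact sub_eq_zero.1 h2

/-! ### Sets of columns remain unsuccessful -/

/-- A set of columns `B` that is successful at `h'` is successful at any smaller `h`. In the quotient
by `F`, the line of the classes of `v̂(·)` meets the cone generated by the coordinate vectors with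
indices in `B` at a single parameter, and among the values up to the maximum those with `B`
successful are the ones below this parameter. -/
theorem IsOptimalValue.exists_isBasicVector_of_le {lp : LinearProgram n m} {ho h h' : ℝ}
    (hopt : lp.IsOptimalValue ho) (hst : StrictlyTangent lp.rangeSpace) (hh : h ≤ h')
    (hh' : h' ≤ ho) {B : Finset (Fin n)} {y : AugSpace n}
    (hy : IsBasicVector (lp.testMatrix h') B y) :
    ∃ z, IsBasicVector (lp.testMatrix h) B z := by
  obtain ⟨β, hβ, hyβ, -⟩ := hopt.exists_calibration hst hh' hy
  obtain ⟨hB, -, hyP, hyl, hys⟩ := (lp.isBasicVector_testMatrix_iff h' B y).1 hy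
  have hb : lp.augBound h = lp.augBound h' + (h' - h) • lastVector n := lp.augBound_eq h h'
  have hδ : 0 ≤ β * (h' - h) := mul_nonneg hβ.le (sub_nonneg.2 hh)
  have hδ1 : 0 < 1 + β * (h' - h) := by linarith
  refine ⟨(1 + β * (h' - h))⁻¹ • (y + (β * (h' - h)) • lastVector n),
    (lp.isBasicVector_testMatrix_iff h B _).2 ⟨?_, ⟨(1 + β * (h' - h))⁻¹ * β, ?_⟩, ?_, ?_, ?_⟩⟩
  · intro z γ hz hzl hzs
    -- Adding `γ (h' - h) y` cancels the last coordinate introduced by the passage from `h` to `h'`.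
    have h1 : z + (γ * (h' - h)) • (y - lastVector n) = 0 := by
      refine hB _ (γ + γ * (h' - h) * β) ?_ (by simp [hzl, hyl]) fun k hk => by
        simp [hzs k hk, hys k hk]
      have := Submodule.add_mem _ hz (Submodule.smul_mem _ (γ * (h' - h)) hyβ)
      rw [hb] at this
      convert this using 1
      module
    have h2 : z = -((γ * (h' - h)) • (y - lastVector n)) := eq_neg_of_add_eq_zero_left h1
    have h3 : (γ * (1 + β * (h' - h))) • y ∈ lp.rangeSpace := by
      have h4 := Submodule.sub_mem _ (Submodule.smul_mem _ γ hyβ) (Submodule.smul_mem _ β hz)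
      rw [h2, hb] at h4
      convert h4 using 1
      module
    have hγ : γ = 0 := by
      by_contra hγ
      have h4 := (Submodule.smul_mem_iff _ (mul_ne_zero hγ hδ1.ne')).1 h3
      rw [hst.eq_zero h4 hyP] at hyl
      simp at hyl
    rw [h2, hγ]
    simp
  · have := Submodule.smul_mem _ (1 + β * (h' - h))⁻¹ hyβ
    rw [hb]
    convert this using 1
    module
  · exact nonnegOrthant_smul (nonnegOrthant_add_smul_lastVector hyP hδ) (inv_nonneg.2 hδ1.le)
  · simp only [PiLp.smul_apply, PiLp.add_apply, hyl, lastVector_last, smul_eq_mul, mul_one]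
    exact inv_mul_cancel₀ hδ1.ne'
  · intro k hk
    simp [hys k hk]

/-- A successful set of columns `B` is not successful at the next value of `h`: there `v̂` belongs,
modulo `F`, to the span of the coordinate vectors with indices in `B`. So either the columns in `B`
are no longer independent, or `v̂` is in `F` and the cone `N(T) ∩ P` is trivial. -/
theorem IsOptimalValue.not_isBasicVector_add_inv {lp : LinearProgram n m} {ho h β : ℝ}
    (hopt : lp.IsOptimalValue ho) (hst : StrictlyTangent lp.rangeSpace) (hβ : 0 < β)
    (hle : h + β⁻¹ ≤ ho) {B : Finset (Fin n)} {y : AugSpace n}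
    (hy : IsBasicVector (lp.testMatrix h) B y)
    (hyβ : y - β • lp.augBound h ∈ lp.rangeSpace) (z : AugSpace n) :
    ¬ IsBasicVector (lp.testMatrix (h + β⁻¹)) B z := by
  intro hz
  obtain ⟨-, -, hyP, hyl, hys⟩ := (lp.isBasicVector_testMatrix_iff h B y).1 hy
  obtain ⟨γ, hγ, hzγ, hle'⟩ := hopt.exists_calibration hst hle hz
  obtain ⟨hB, -, hzP, hzl, hzs⟩ := (lp.isBasicVector_testMatrix_iff _ B z).1 hz
  have hlt : h + β⁻¹ < ho := by
    have := inv_pos.2 hγ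
    linarith
  have hb : lp.augBound h = lp.augBound (h + β⁻¹) + β⁻¹ • lastVector n := by
    rw [lp.augBound_eq h (h + β⁻¹), add_sub_cancel_left]
  have h1 : y - lastVector n - β • lp.augBound (h + β⁻¹) ∈ lp.rangeSpace := by
    rw [hb, smul_add, smul_smul, mul_inv_cancel₀ hβ.ne', one_smul] at hyβ
    convert hyβ using 1
    abel
  rw [hB _ β h1 (by simp [hyl]) fun k hk => by simp [hys k hk], zero_sub,
    Submodule.neg_mem_iff, Submodule.smul_mem_iff _ hβ.ne'] at h1
  exact hopt.augBound_notMem hst hlt h1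

end LinearProgram

/-! ### Existence of a successful set of columns -/

namespace LinearProgram

variable {n m : ℕ}

/-- The ratio test: a vector of the contact polytope with positive last entry can be moved in a
direction of `F`, supported where it is itself nonzero, until one more entry vanishes, the last
entry remaining positive. -/
theorem exists_mem_contactPolytope_support_ssubset (lp : LinearProgram n m)
    (hst : StrictlyTangent lp.rangeSpace) {h : ℝ} {g : AugSpace n} (hg : g ∈ lp.contactPolytope h)
    (hgl : 0 < g (Fin.last n)) {z : AugSpace n} (hz : z ∈ lp.rangeSpace) (hz0 : z ≠ 0)
    (hzs : ∀ k : Fin n, g k.castSucc = 0 → z k.castSucc = 0) :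
    ∃ g' ∈ lp.contactPolytope h, 0 < g' (Fin.last n) ∧
      (∀ k : Fin n, g k.castSucc = 0 → g' k.castSucc = 0) ∧
      ∃ k : Fin n, g k.castSucc ≠ 0 ∧ g' k.castSucc = 0 := by
  wlog hzl : 0 ≤ z (Fin.last n) generalizing z
  · refine this (Submodule.neg_mem _ hz) (neg_ne_zero.2 hz0) (fun k hk => ?_) ?_
    · simp [hzs k hk]
    · rw [PiLp.neg_apply]
      linarith
  have hneg : ∃ k : Fin n, z k.castSucc < 0 := by
    by_contra! hpos
    exact hz0 (hst.eq_zero hz fun k => Fin.lastCases hzl hpos k)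
  obtain ⟨k₀, hk₀, hmin⟩ := Finset.exists_min_image
    (Finset.univ.filter fun k : Fin n => z k.castSucc < 0)
    (fun k => g k.castSucc / -z k.castSucc) (by simpa [Finset.Nonempty] using hneg)
  rw [Finset.mem_filter_univ] at hk₀
  have hgP := hg.2
  have ht : 0 ≤ g k₀.castSucc / -z k₀.castSucc := div_nonneg (hgP _) (by linarith)
  set t := g k₀.castSucc / -z k₀.castSucc with ht_def
  have hl : 0 < g (Fin.last n) + t * z (Fin.last n) := by
    have := mul_nonneg ht hzl
    linarith
  refine ⟨g + t • z, ⟨?_, fun k => ?_⟩, by simpa using hl, fun k hk => by simp [hk, hzs k hk],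
    k₀, fun h0 => hk₀.ne (hzs k₀ h0), ?_⟩
  · change g + t • z - lp.augBound h ∈ lp.rangeSpace
    have := Submodule.add_mem _ hg.1 (Submodule.smul_mem _ t hz)
    convert this using 1
    module
  · refine Fin.lastCases (by simpa using hl.le) (fun k => ?_) k
    change 0 ≤ g k.castSucc + t * z k.castSucc
    rcases lt_or_ge (z k.castSucc) 0 with hk | hk
    · have h1 := hmin k (by simpa using hk)
      rw [le_div_iff₀ (by linarith)] at h1
      linarith
    · exact add_nonneg (hgP _) (mul_nonneg ht hk)
  · change g k₀.castSucc + t * z k₀.castSucc = 0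
    have : z k₀.castSucc ≠ 0 := hk₀.ne
    rw [ht_def]
    field_simp
    ring

/-- Below the maximum some set of columns is successful. A vector of the contact polytope with
positive last entry and minimal support is supported on indices which are independent modulo `F`,
and completing them to a basis provides the set of columns. -/
theorem IsOptimalValue.exists_isBasicVector {lp : LinearProgram n m} {ho h : ℝ}
    (hopt : lp.IsOptimalValue ho) (hst : StrictlyTangent lp.rangeSpace) (hh : h < ho) :
    ∃ (B : Finset (Fin n)) (y : AugSpace n), B.card = (lp.testMatrix h).rank ∧
      IsBasicVector (lp.testMatrix h) B y := by
  classical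
  obtain ⟨g₀, hg₀, hg₀l⟩ := hopt.exists_mem_contactPolytope hh.le
  let supp : AugSpace n → Finset (Fin n) := fun g => Finset.univ.filter fun k => g k.castSucc ≠ 0
  have hsupp : ∀ g k, k ∈ supp g ↔ g k.castSucc ≠ 0 := fun g k => by simp [supp]
  obtain ⟨g, ⟨hg, hgl⟩, hmin⟩ := (measure fun g => (supp g).card).wf.has_min
    {g | g ∈ lp.contactPolytope h ∧ 0 < g (Fin.last n)} ⟨g₀, hg₀, by rw [hg₀l]; linarith⟩
  have hind : ∀ z ∈ lp.rangeSpace, (∀ k, k ∉ supp g → z k.castSucc = 0) → z = 0 := by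
    intro z hz hzs
    by_contra hz0
    obtain ⟨g', hg', hg'l, hs, k, hk, hk'⟩ :=
      lp.exists_mem_contactPolytope_support_ssubset hst hg hgl hz hz0
        fun k hk => hzs k (by simp [hsupp, hk])
    refine hmin g' ⟨hg', hg'l⟩ (Finset.card_lt_card ?_)
    refine Finset.ssubset_iff_of_subset (fun k hk => ?_) |>.2 ⟨k, (hsupp g k).2 hk, ?_⟩
    · rw [hsupp] at hk ⊢
      exact fun h0 => hk (hs k h0)
    · simp [hsupp, hk']
  obtain ⟨B, hSB, hcard, hB⟩ := exists_card_eq_of_independent_mod lp.rangeSpace (supp g) hind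
  have hgs : ∀ k, k ∉ B → g k.castSucc = 0 := by
    intro k hk
    by_contra h0
    exact hk (hSB ((hsupp g k).2 h0))
  refine ⟨B, (g (Fin.last n))⁻¹ • g, ?_, (lp.isBasicVector_testMatrix_iff h B _).2
    ⟨fun z γ hz hzl hzs => ?_, ⟨(g (Fin.last n))⁻¹, ?_⟩,
      nonnegOrthant_smul hg.2 (inv_nonneg.2 hgl.le), by simp [hgl.ne'], fun k hk => by
      simp [hgs k hk]⟩⟩
  · have := lp.rank_testMatrix (hopt.augBound_notMem hst hh)
    omega
  · have h1 : z - γ • g = 0 := by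
      refine hB _ ?_ fun k hk => by simp [hzs k hk, hgs k hk]
      have := Submodule.sub_mem _ hz (Submodule.smul_mem _ γ hg.1)
      convert this using 1
      module
    have h2 : z (Fin.last n) - γ * g (Fin.last n) = 0 := by
      simpa using congrArg (fun w : AugSpace n => w (Fin.last n)) h1
    have hγ : γ = 0 := by
      rw [hzl, zero_sub, neg_eq_zero] at h2
      exact (mul_eq_zero.1 h2).resolve_right hgl.ne'
    simpa [hγ] using h1
  · rw [← smul_sub]
    exact Submodule.smul_mem _ _ hg.1

end LinearProgram

/-! ### The search and the run of the algorithm -/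

theorem isBasicVector_of_basicVector_eq_some {n : ℕ} {M : Matrix (Fin (n + 1)) (Fin (n + 1)) ℝ}
    {B : Finset (Fin n)} {y : AugSpace n} (h : basicVector M B = some y) :
    IsBasicVector M B y := by
  unfold basicVector at h
  split_ifs at h with hy
  rw [← Option.some.inj h]
  exact hy.choose_spec

theorem not_isBasicVector_of_basicVector_eq_none {n : ℕ}
    {M : Matrix (Fin (n + 1)) (Fin (n + 1)) ℝ} {B : Finset (Fin n)} (h : basicVector M B = none)
    (y : AugSpace n) : ¬ IsBasicVector M B y := by
  unfold basicVector at h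
  split_ifs at h with hy
  exact fun h' => hy ⟨y, h'⟩

theorem not_isBasicVector_of_generatorSearch_eq_none {n : ℕ}
    {M : Matrix (Fin (n + 1)) (Fin (n + 1)) ℝ} {l : List (Finset (Fin n))}
    (h : generatorSearch M l = none) : ∀ B ∈ l, ∀ y, ¬ IsBasicVector M B y := by
  induction l with
  | nil => simp
  | cons A l ih =>
    rw [generatorSearch] at h
    split at h
    · simp at h
    · rename_i hA
      intro B hB
      rcases List.mem_cons.1 hB with rfl | hB
      · exact not_isBasicVector_of_basicVector_eq_none hA
      · exact ih h B hB

theorem exists_of_generatorSearch_eq_some {n : ℕ} {M : Matrix (Fin (n + 1)) (Fin (n + 1)) ℝ}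
    {l rest : List (Finset (Fin n))} {y : AugSpace n}
    (h : generatorSearch M l = some (y, rest)) :
    ∃ (pre : List (Finset (Fin n))) (B : Finset (Fin n)), l = pre ++ B :: rest ∧
      IsBasicVector M B y ∧ ∀ A ∈ pre, ∀ z, ¬ IsBasicVector M A z := by
  induction l with
  | nil => simp [generatorSearch] at h
  | cons A l ih =>
    rw [generatorSearch] at h
    split at h
    · rename_i y' hA
      obtain ⟨rfl, rfl⟩ := Prod.mk.inj (Option.some.inj h)
      exact ⟨[], A, rfl, isBasicVector_of_basicVector_eq_some hA, by simp⟩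
    · rename_i hA
      obtain ⟨pre, B, rfl, hB, hpre⟩ := ih h
      refine ⟨A :: pre, B, rfl, hB, fun A' hA' => ?_⟩
      rcases List.mem_cons.1 hA' with rfl | hA'
      · exact not_isBasicVector_of_basicVector_eq_none hA
      · exact hpre A' hA'

namespace LinearProgram

variable {n m : ℕ}

theorem evolutiveStep_eq_none_iff (lp : LinearProgram n m) (s : EvolutiveState n) :
    lp.evolutiveStep s = none ↔ generatorSearch (lp.testMatrix s.h) s.rest = none := by
  unfold evolutiveStep
  split <;> simp_all

theorem exists_of_evolutiveStep_eq_some (lp : LinearProgram n m) {s s' : EvolutiveState n}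
    (h : lp.evolutiveStep s = some s') :
    ∃ y, generatorSearch (lp.testMatrix s.h) s.rest = some (y, s'.rest) ∧
      s'.h = s.h + lp.calibrate s.h y (Fin.last n) := by
  unfold evolutiveStep at h
  split at h
  · rename_i y rest hs
    obtain rfl := Option.some.inj h
    exact ⟨y, hs, rfl⟩
  · simp at h

/-- Calibration of a successful vector divides it by its number `β`. -/
theorem IsOptimalValue.exists_calibrate_eq {lp : LinearProgram n m} {ho h : ℝ}
    (hopt : lp.IsOptimalValue ho) (hst : StrictlyTangent lp.rangeSpace) (hh : h ≤ ho)
    {B : Finset (Fin n)} {y : AugSpace n} (hy : IsBasicVector (lp.testMatrix h) B y) :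
    ∃ β : ℝ, 0 < β ∧ y - β • lp.augBound h ∈ lp.rangeSpace ∧ h + β⁻¹ ≤ ho ∧
      lp.calibrate h y = β⁻¹ • y ∧ lp.calibrate h y (Fin.last n) = β⁻¹ := by
  obtain ⟨β, hβ, hyβ, hle⟩ := hopt.exists_calibration hst hh hy
  have hlt : h < ho := by
    have := inv_pos.2 hβ
    linarith
  have hc : lp.calibrate h y = β⁻¹ • y := by
    rw [calibrate, lp.calibrationFactor_eq (hopt.augBound_notMem hst hlt) hyβ]
  refine ⟨β, hβ, hyβ, hle, hc, ?_⟩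
  rw [hc, PiLp.smul_apply, hy.2.2.2.1, smul_eq_mul, mul_one]

/-- The invariants of the loop. The third one, that no set of columns examined so far is successful
with the current matrix, is what justifies resuming the search instead of restarting it. -/
theorem IsOptimalValue.evolutiveRun_invariant {lp : LinearProgram n m} {ho h : ℝ}
    (hopt : lp.IsOptimalValue ho) (hst : StrictlyTangent lp.rangeSpace) (hh : h ≤ ho)
    (L : List (Finset (Fin n))) {i : ℕ} {s : EvolutiveState n}
    (hs : lp.evolutiveRun h L i = some s) :
    s.h ≤ ho ∧ s.rest.length + i ≤ L.length ∧
      ∀ B ∈ L, B ∉ s.rest → ∀ y, ¬ IsBasicVector (lp.testMatrix s.h) B y := by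
  induction i generalizing s with
  | zero =>
    obtain rfl := Option.some.inj hs
    exact ⟨hh, by simp, fun B hB hB' => absurd hB hB'⟩
  | succ i ih =>
    obtain ⟨s₀, hs₀, hstep⟩ := Option.bind_eq_some_iff.1 hs
    obtain ⟨hle, hlen, hinv⟩ := ih hs₀
    obtain ⟨y, hsearch, hsh⟩ := lp.exists_of_evolutiveStep_eq_some hstep
    obtain ⟨pre, B₀, hsplit, hy, hpre⟩ := exists_of_generatorSearch_eq_some hsearch
    obtain ⟨β, hβ, hyβ, hle', -, hl⟩ := hopt.exists_calibrate_eq hst hle hy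
    rw [hl] at hsh
    refine ⟨hsh ▸ hle', ?_, fun B hB hB' y' hy' => ?_⟩
    · rw [hsplit, List.length_append, List.length_cons] at hlen
      omega
    · rw [hsh] at hy'
      obtain ⟨z, hz⟩ := hopt.exists_isBasicVector_of_le hst
        (le_add_of_nonneg_right (inv_nonneg.2 hβ.le)) hle' hy'
      by_cases hB₀ : B = B₀
      · subst hB₀
        exact hopt.not_isBasicVector_add_inv hst hβ hle' hy hyβ y' hy'
      · by_cases hp : B ∈ pre
        · exact hpre B hp z hz
        · exact hinv B hB (by simp [hsplit, hp, hB₀, hB']) z hz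

theorem IsOptimalValue.exists_exitsAt {lp : LinearProgram n m} {ho h : ℝ}
    (hopt : lp.IsOptimalValue ho) (hst : StrictlyTangent lp.rangeSpace) (hh : h ≤ ho)
    (L : List (Finset (Fin n))) : ∃ (j : ℕ) (s : EvolutiveState n), lp.ExitsAt h L j s := by
  by_contra! hno
  have hrun : ∀ i, ∃ s, lp.evolutiveRun h L i = some s := by
    intro i
    induction i with
    | zero => exact ⟨_, rfl⟩
    | succ i ih =>
      obtain ⟨s, hs⟩ := ih
      obtain ⟨s', hs'⟩ := Option.ne_none_iff_exists'.1 fun h0 => hno i s ⟨hs, h0⟩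
      exact ⟨s', by rw [evolutiveRun, hs, Option.bind_some, hs']⟩
  obtain ⟨s, hs⟩ := hrun (L.length + 1)
  have := (hopt.evolutiveRun_invariant hst hh L hs).2.1
  omega

/-- At the exit no set of columns of the whole list is successful, which happens at the maximum
only. -/
theorem IsOptimalValue.eq_of_exitsAt {lp : LinearProgram n m} {ho h : ℝ}
    (hopt : lp.IsOptimalValue ho) (hst : StrictlyTangent lp.rangeSpace) (hh : h < ho)
    {L : List (Finset (Fin n))} (hL : lp.IsColumnEnumeration h L) {j : ℕ} {s : EvolutiveState n}
    (hs : lp.ExitsAt h L j s) : s.h = ho := by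
  obtain ⟨hle, -, hinv⟩ := hopt.evolutiveRun_invariant hst hh.le L hs.1
  by_contra hne
  have hlt := lt_of_le_of_ne hle hne
  obtain ⟨B, y, hcard, hy⟩ := hopt.exists_isBasicVector hst hlt
  have hBL : B ∈ L := by
    have h1 := lp.rank_testMatrix (hopt.augBound_notMem hst hlt)
    have h2 := lp.rank_testMatrix (hopt.augBound_notMem hst hh)
    rw [hL.2]
    omega
  by_cases hB : B ∈ s.rest
  · exact not_isBasicVector_of_generatorSearch_eq_none
      ((lp.evolutiveStep_eq_none_iff s).1 hs.2) B hB y hy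
  · exact hinv B hBL hB y hy

end LinearProgram

theorem mainTheorem10 {n m : ℕ} (lp : LinearProgram n m)
    (hst : StrictlyTangent lp.rangeSpace) (hfeas : lp.feasibleSet.Nonempty) :
    ∃ ho : ℝ, lp.IsOptimalValue ho ∧
      ∀ h : ℝ, h < ho → ∀ L : List (Finset (Fin n)), lp.IsColumnEnumeration h L →
        (∃ (j : ℕ) (s : EvolutiveState n), lp.ExitsAt h L j s) ∧
        (∀ (j : ℕ) (s : EvolutiveState n), lp.ExitsAt h L j s → s.h = ho) ∧
        (∀ (i : ℕ) (s s' : EvolutiveState n), lp.evolutiveRun h L i = some s →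
          lp.evolutiveRun h L (i + 1) = some s' →
          ∃ y : AugSpace n, generatorSearch (lp.testMatrix s.h) s.rest = some (y, s'.rest) ∧
            lp.IsCalibratedGenerator s.h (lp.calibrate s.h y) ∧
            0 < lp.calibrate s.h y (Fin.last n) ∧
            s'.h = s.h + lp.calibrate s.h y (Fin.last n)) := by
  obtain ⟨ho, hopt⟩ := lp.exists_isOptimalValue hst hfeas
  refine ⟨ho, hopt, fun h hh L hL => ⟨hopt.exists_exitsAt hst hh.le L,
    fun j s hs => hopt.eq_of_exitsAt hst hh hL hs, fun i s s' hs hs' => ?_⟩⟩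
  have hle := (hopt.evolutiveRun_invariant hst hh.le L hs).1
  rw [LinearProgram.evolutiveRun, hs, Option.bind_some] at hs'
  obtain ⟨y, hsearch, hsh⟩ := lp.exists_of_evolutiveStep_eq_some hs'
  obtain ⟨-, B, -, hy, -⟩ := exists_of_generatorSearch_eq_some hsearch
  obtain ⟨β, hβ, hyβ, -, hc, hl⟩ := hopt.exists_calibrate_eq hst hle hy
  refine ⟨y, hsearch, ⟨?_, ?_⟩, hl ▸ inv_pos.2 hβ, hsh⟩
  · rw [hc]
    exact lp.isConeGenerator_smul_of_isBasicVector hy (inv_pos.2 hβ)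
  · rw [hc]
    exact lp.inv_smul_mem_contactPolytope hβ hy.2.2.1 hyβ
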